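/- **Setting.** Consider $\dot x=f(x,u)+g(x,u)$, $z=h(t,x)$ with state $x\in\mathbb X\subset\mathbb R^m$, input $u\in\mathbb U\subset\mathbb R^{m_u}$ and output $z\in\mathbb R^{m_z}$, where $g$ is known, $h$ is known and differentiable on $[0,\infty)\times\mathbb X$, and $f=(f_1,\dots,f_m)$ is unknown (fixed or random). A control law is a map $\pi(t,x,\mu)$ that may depend on a whole model $\mu$ of $f$; write $\xi(t,x,\mu)=[x^\top,\pi(t,x,\mu)^\top]^\top$. All norms are Euclidean. **ISS-type Lyapunov condition.** There are a differentiable $V:[0,\infty)\times\mathbb R^{m_z}\to[0,\infty)$, class-$\mathcal K$ functions $\underline\alpha,\bar\alpha,\alpha:[0,\infty)\to[0,\infty)$ and $\varepsilon>0$ with $\underline\alpha(\|z\|)\le V(t,z)\le\bar\alpha(\|z\|)$ for all $t\ge 0$, $z$, such that for every model $\mu$ in a given class $\mathcal M$ and all $t\ge0$, $x\in\mathbb X$ with $\pi(t,x,\mu)\in\mathbb U$, $$\nabla_xV(t,x)\,\bigl(\mu(\xi(t,x,\mu))+g(\xi(t,x,\mu))\bigr)+\nabla_tV(t,x)\le-\alpha\bigl(V(t,h(t,x))\bigr)-\frac{\|\nabla_xV(t,x)\|^2}{4\varepsilon},$$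 where $\nabla_xV=\frac{\partial V}{\partial z}(t,h(t,x))\,\frac{\partial h}{\partial x}(t,x)$ and $\nabla_tV=\frac{\partial V}{\partial t}(t,h(t,x))+\frac{\partial V}{\partial z}(t,h(t,x))\,\frac{\partial h}{\partial t}(t,x)$. **Theorem.** Let $\pi$ satisfy this condition and let $\delta\in(0,1/m)$. (a) Let $\mu$ be a learned (random) model with values in $\mathcal M$, and let $\eta=(\eta_1,\dots,\eta_m)$ be a (possibly random) prediction error bound: for each $j$, with probability at least $1-\delta$, $|f_j(\xi)-\mu_j(\xi)|\le\eta_j(\xi)$ for all $\xi\in\mathbb X\times\mathbb U$. Put $\bar\eta=\sup\{\|\eta(\xi(t,x,\mu))\|: t\ge0,\ x\in\mathbb X,\ \pi(t,x,\mu)\in\mathbb U\}$. Then with probability at least $1-m\delta$, every solution $x:[0,\infty)\to\mathbb X$ of the true system with $u(t)=\pi(t,x(t),\mu)\in\mathbb U$ satisfies $$\limsup_{t\to\infty}\|z(t)\|\le\underline\alpha^{-1}\bigl(\alpha^{-1}(\varepsilon\bar\eta^2)\bigr),$$ where the inverse of a class-$\mathcal K$ function is $+\infty$ above its range. (b) The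 conclusion of (a) holds in particular for Gaussian process models with their explicit error bound. Let $n=m+m_u$ and let $B=\prod_{k=1}^n[\underline x_k,\bar x_k]$ be a box containing $\mathbb X\times\mathbb U$. Assume that each $f_j$ is on $B$ a sample of a centred Gaussian process with covariance kernel $\kappa_j$; that for each $j$ there are $\bar{\mathcal N}$ experts, expert $i$ having finitely many training inputs in $B$ and training outputs equal to $f_j$ at these inputs plus i.i.d. $N(0,\sigma_{n,j}^2)$ noise ($\sigma_{n,j}>0$) independent of $f_j$; let $\mu_{j,i},\sigma_{j,i}$ be the Gaussian process posterior mean and standard deviation of expert $i$ and $\mu_j(\xi)=\sum_i\omega_{j,i}(\xi)\mu_{j,i}(\xi)$ with (possibly random) weights $\omega_{j,i}\ge0$, $\sum_i\omega_{j,i}=1$; and assume $\mu\in\mathcal M$. Let $\tau>0$, and let $L_{\mu,j,i}$, $L_{\sigma,j,i}$, $L_{f,j}$ be Lipschitz constants on $B$ of $\mu_{j,i}$, $\sigma_{j,i}$, $f_j$ (those of the random functions $\mu_{j,i}$ and $f_j$ may be random). Then the conclusion of (a) holds with $$\eta_j(\xi)=2\sqrt{\beta_\delta}\sum_i\omega_{j,i}(\xi)\sigma_{j,i}(\xi)+\sum_i\omega_{j,i}(\xi)\bigl(\sqrt{\beta_\delta}\,L_{\sigma,j,i}+L_{f,j}+L_{\mu,j,i}\bigr)\tau,$$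 $$\beta_\delta=2\sum_{k=1}^{n}\log\max\Bigl\{1,\Bigl\lceil\tfrac{\sqrt n}{2\tau}(\bar x_k-\underline x_k)\Bigr\rceil\Bigr\}-2\log\frac{\delta}{n\,\bar{\mathcal N}}.$$ -/

import Mathlib

open Set Filter Topology MeasureTheory ProbabilityTheory
open scoped ENNReal NNReal Matrix

noncomputable section

/-! ### Spaces -/

/-- `ℝⁿ` with the Euclidean norm. -/
abbrev Vec (n : ℕ) := EuclideanSpace ℝ (Fin n)

/-- The space of stacked state-input vectors `ξ = [xᵀ, uᵀ]ᵀ`. -/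
abbrev StateInput (m mu : ℕ) := EuclideanSpace ℝ (Fin m ⊕ Fin mu)

/-- The stacked vector `[xᵀ, uᵀ]ᵀ`. -/
def stack {m mu : ℕ} (x : Vec m) (u : Vec mu) : StateInput m mu :=
  WithLp.toLp 2 (Sum.elim (fun i => x i) (fun k => u k))

/-- The joint domain `𝕏ₑ = 𝕏 × 𝕌`, as a set of stacked vectors. -/
def jointDomain {m mu : ℕ} (𝕏 : Set (Vec m)) (𝕌 : Set (Vec mu)) : Set (StateInput m mu) :=
  {ξ | ∃ x ∈ 𝕏, ∃ u ∈ 𝕌, ξ = stack x u}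

/-- A control law `π(t, x, μ)`, which may use the whole model `μ`. -/
abbrev ControlLaw (m mu : ℕ) := ℝ → Vec m → (StateInput m mu → Vec m) → Vec mu

/-- `ξ(t, x, μ) = [xᵀ, π(t, x, μ)ᵀ]ᵀ`. -/
def closedLoopInput {m mu : ℕ} (π : ControlLaw m mu) (μ : StateInput m mu → Vec m)
    (t : ℝ) (x : Vec m) : StateInput m mu :=
  stack x (π t x μ)

/-! ### Class-K functions -/

/-- Class-K functions `[0, ∞) → [0, ∞)`; only the values on `[0, ∞)` matter. -/
structure IsClassK (α : ℝ → ℝ) : Prop where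
  continuousOn : ContinuousOn α (Ici 0)
  strictMonoOn : StrictMonoOn α (Ici 0)
  map_zero : α 0 = 0

/-- The inverse of a class-K function with values in `[0, ∞]`: it is the inverse function on the
range of `α`, and `∞` at the levels that lie above the range of `α`. -/
def classKInv (α : ℝ → ℝ) (s : ℝ≥0∞) : ℝ≥0∞ :=
  sSup {y | ∃ r : ℝ, 0 ≤ r ∧ ENNReal.ofReal (α r) ≤ s ∧ y = ENNReal.ofReal r}

theorem IsClassK.nonneg {α : ℝ → ℝ} (h : IsClassK α) {r : ℝ} (hr : 0 ≤ r) : 0 ≤ α r := by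
  rw [← h.map_zero]
  exact h.strictMonoOn.monotoneOn self_mem_Ici hr hr

theorem classKInv_apply {α : ℝ → ℝ} (h : IsClassK α) {r : ℝ} (hr : 0 ≤ r) :
    classKInv α (ENNReal.ofReal (α r)) = ENNReal.ofReal r := by
  apply le_antisymm
  · refine sSup_le ?_
    rintro y ⟨q, hq, hle, rfl⟩
    rw [ENNReal.ofReal_le_ofReal_iff (h.nonneg hr)] at hle
    exact ENNReal.ofReal_le_ofReal ((h.strictMonoOn.le_iff_le hq hr).1 hle)
  · exact le_sSup ⟨r, hr, le_rfl, rfl⟩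

/-! ### The ISS-type Lyapunov condition -/

/-- `∂V/∂z (t, h(t, x))`. -/
def partialZ {m mz : ℕ} (h : ℝ → Vec m → Vec mz) (V : ℝ → Vec mz → ℝ) (t : ℝ) (x : Vec m) :
    Vec mz →L[ℝ] ℝ :=
  (fderivWithin ℝ (fun p : ℝ × Vec mz => V p.1 p.2) (Ici 0 ×ˢ univ) (t, h t x)).comp
    (ContinuousLinearMap.inr ℝ ℝ (Vec mz))

/-- The derivative of the output map `h` on `[0, ∞) × 𝕏`, jointly in `(t, x)`. -/
def outputDeriv {m mz : ℕ} (𝕏 : Set (Vec m)) (h : ℝ → Vec m → Vec mz) (t : ℝ) (x : Vec m) :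
    ℝ × Vec m →L[ℝ] Vec mz :=
  fderivWithin ℝ (fun p : ℝ × Vec m => h p.1 p.2) (Ici 0 ×ˢ 𝕏) (t, x)

/-- `∇ₓV(t, x) = ∂V/∂h · ∂h/∂x`, as a linear functional (a row vector); its operator norm is the
Euclidean norm of the row vector. -/
def gradX {m mz : ℕ} (𝕏 : Set (Vec m)) (h : ℝ → Vec m → Vec mz) (V : ℝ → Vec mz → ℝ)
    (t : ℝ) (x : Vec m) : Vec m →L[ℝ] ℝ :=
  (partialZ h V t x).comp
    ((outputDeriv 𝕏 h t x).comp (ContinuousLinearMap.inr ℝ ℝ (Vec m)))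

/-- `∇ₜV(t, x) = ∂V/∂t + ∂V/∂h · ∂h/∂t`. -/
def gradT {m mz : ℕ} (𝕏 : Set (Vec m)) (h : ℝ → Vec m → Vec mz) (V : ℝ → Vec mz → ℝ)
    (t : ℝ) (x : Vec m) : ℝ :=
  fderivWithin ℝ (fun p : ℝ × Vec mz => V p.1 p.2) (Ici 0 ×ˢ univ) (t, h t x) (1, 0)
    + partialZ h V t x (outputDeriv 𝕏 h t x (1, 0))

/-- The control law `π` satisfies the ISS-type Lyapunov condition, with Lyapunov function `V`,
class-K functions `αlo`, `αhi`, `α` and constant `ε`, for every model `μ` of the class `𝓜`. The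
model and `g` matter on `𝕏 × 𝕌` only; the restriction `π t x μ ∈ 𝕌` is void for a control law with
values in `𝕌`. -/
structure ISSLyapunovCondition {m mu mz : ℕ} (𝕏 : Set (Vec m)) (𝕌 : Set (Vec mu))
    (g : StateInput m mu → Vec m) (h : ℝ → Vec m → Vec mz)
    (𝓜 : Set (StateInput m mu → Vec m)) (π : ControlLaw m mu)
    (V : ℝ → Vec mz → ℝ) (αlo αhi α : ℝ → ℝ) (ε : ℝ) : Prop where
  differentiable : DifferentiableOn ℝ (fun p : ℝ × Vec mz => V p.1 p.2) (Ici 0 ×ˢ univ)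
  classK_lo : IsClassK αlo
  classK_hi : IsClassK αhi
  classK : IsClassK α
  lower : ∀ t : ℝ, 0 ≤ t → ∀ z, αlo ‖z‖ ≤ V t z
  upper : ∀ t : ℝ, 0 ≤ t → ∀ z, V t z ≤ αhi ‖z‖
  eps_pos : 0 < ε
  decrease : ∀ μ ∈ 𝓜, ∀ t : ℝ, 0 ≤ t → ∀ x ∈ 𝕏, π t x μ ∈ 𝕌 →
    gradX 𝕏 h V t x (μ (closedLoopInput π μ t x) + g (closedLoopInput π μ t x)) + gradT 𝕏 h V t x
      ≤ - α (V t (h t x)) - ‖gradX 𝕏 h V t x‖ ^ 2 / (4 * ε)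

/-! ### The closed loop -/

/-- `x` is a solution on `[0, ∞)` of the true system `ẋ = f(x, u) + g(x, u)`, `x ∈ 𝕏`, `u ∈ 𝕌`,
under `u = π(t, x, μ)`. -/
def IsClosedLoopTrajectory {m mu : ℕ} (𝕏 : Set (Vec m)) (𝕌 : Set (Vec mu)) (f g μ : StateInput m mu → Vec m)
    (π : ControlLaw m mu) (x : ℝ → Vec m) : Prop :=
  ∀ t : ℝ, 0 ≤ t → x t ∈ 𝕏 ∧ π t (x t) μ ∈ 𝕌 ∧
    HasDerivWithinAt x
      (f (closedLoopInput π μ t (x t)) + g (closedLoopInput π μ t (x t))) (Ici 0) t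

/-- The output `z(t) = h(t, x(t))` of the true system is ultimately bounded by `b`, along every
closed-loop trajectory. -/
def OutputUltimatelyBounded {m mu mz : ℕ} (𝕏 : Set (Vec m)) (𝕌 : Set (Vec mu))
    (f g μ : StateInput m mu → Vec m) (h : ℝ → Vec m → Vec mz) (π : ControlLaw m mu) (b : ℝ≥0∞) : Prop :=
  ∀ x : ℝ → Vec m, IsClosedLoopTrajectory 𝕏 𝕌 f g μ π x →
    limsup (fun t : ℝ => ‖h t (x t)‖ₑ) atTop ≤ b

/-- `η̄ = sup {‖η(ξ(t, x, μ))‖ : t ≥ 0, x ∈ 𝕏}`, over the points with an admissible input (all of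
them, if the control law has values in `𝕌`). -/
def worstCaseError {m mu : ℕ} (𝕏 : Set (Vec m)) (𝕌 : Set (Vec mu)) (π : ControlLaw m mu)
    (μ η : StateInput m mu → Vec m) : ℝ≥0∞ :=
  ⨆ (t : ℝ) (_ : 0 ≤ t) (x : Vec m) (_ : x ∈ 𝕏) (_ : π t x μ ∈ 𝕌),
    ‖η (closedLoopInput π μ t x)‖ₑ

/-- The event `S` (possibly not measurable) has probability at least `p`: it contains a measurable
event of probability at least `p`. -/
def HoldsWithProb {Ω : Type*} [MeasurableSpace Ω] (P : Measure Ω) (p : ℝ) (S : Set Ω) : Prop :=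
  ∃ E : Set Ω, MeasurableSet E ∧ E ⊆ S ∧ ENNReal.ofReal p ≤ P E

/-! ### Gaussian process regression -/

section GP

variable {ι : Type*} [Fintype ι]

/-- `K + σₙ² I`. -/
def noisyGram {N : ℕ} (κ : EuclideanSpace ℝ ι → EuclideanSpace ℝ ι → ℝ) (σn : ℝ)
    (X : Fin N → EuclideanSpace ℝ ι) : Matrix (Fin N) (Fin N) ℝ :=
  Matrix.of (fun s t => κ (X s) (X t)) + σn ^ 2 • (1 : Matrix (Fin N) (Fin N) ℝ)

/-- The posterior mean `κ(ξ, X) (K + σₙ² I)⁻¹ y`. -/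
def postMean {N : ℕ} (κ : EuclideanSpace ℝ ι → EuclideanSpace ℝ ι → ℝ) (σn : ℝ)
    (X : Fin N → EuclideanSpace ℝ ι) (y : Fin N → ℝ) (ξ : EuclideanSpace ℝ ι) : ℝ :=
  (fun s => κ ξ (X s)) ⬝ᵥ ((noisyGram κ σn X)⁻¹ *ᵥ y)

/-- The posterior standard deviation
`σ(ξ) = (κ(ξ, ξ) - κ(ξ, X) (K + σₙ² I)⁻¹ κ(X, ξ))^(1/2)`. -/
def postStd {N : ℕ} (κ : EuclideanSpace ℝ ι → EuclideanSpace ℝ ι → ℝ) (σn : ℝ)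
    (X : Fin N → EuclideanSpace ℝ ι) (ξ : EuclideanSpace ℝ ι) : ℝ :=
  Real.sqrt (κ ξ ξ -
    (fun s => κ ξ (X s)) ⬝ᵥ ((noisyGram κ σn X)⁻¹ *ᵥ (fun s => κ ξ (X s))))

/-- The box `∏ₖ [lo k, hi k]`. -/
def box (lo hi : ι → ℝ) : Set (EuclideanSpace ℝ ι) :=
  {ξ | ∀ k, lo k ≤ ξ k ∧ ξ k ≤ hi k}

/-- `β_δ = 2 ∑ⱼ log ⌈(√n / (2τ)) (hi j - lo j)⌉ - 2 log (δ / n)`, where `n` is the dimension; a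
side of length zero counts as one grid cell. -/
def betaDelta (lo hi : ι → ℝ) (τ δ : ℝ) : ℝ :=
  2 * ∑ k, Real.log
      (max 1 ⌈Real.sqrt (Fintype.card ι) / (2 * τ) * (hi k - lo k)⌉ : ℤ)
    - 2 * Real.log (δ / Fintype.card ι)

end GP

/-- The data of a learned model with `m` outputs on `ℝ^ι`: each output is predicted by `nExp`
Gaussian process experts, whose posterior means are aggregated with weights. The randomness (of the
unknown function, the measurement noise and the weights) lives on `Ω`. -/
structure GPModel (Ω : Type*) (m : ℕ) (ι : Type*) [Fintype ι] where
  /-- Number of experts. -/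
  nExp : ℕ
  /-- Kernel of each output. -/
  κ : Fin m → EuclideanSpace ℝ ι → EuclideanSpace ℝ ι → ℝ
  /-- Noise standard deviation. -/
  σn : Fin m → ℝ
  /-- Number of training points of each expert. -/
  size : Fin m → Fin nExp → ℕ
  /-- Training inputs. -/
  input : ∀ (j : Fin m) (i : Fin nExp), Fin (size j i) → EuclideanSpace ℝ ι
  /-- Measurement noise. -/
  noise : ∀ (j : Fin m) (i : Fin nExp), Fin (size j i) → Ω → ℝ
  /-- Aggregation weights. -/
  weight : Fin m → Fin nExp → Ω → EuclideanSpace ℝ ι → ℝ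
  /-- Lower corner of a box that contains the domain. -/
  lo : ι → ℝ
  /-- Upper corner of a box that contains the domain. -/
  hi : ι → ℝ
  /-- Grid factor. -/
  τ : ℝ
  /-- Lipschitz constants of the posterior standard deviations. -/
  Lσ : Fin m → Fin nExp → ℝ≥0
  /-- Lipschitz constants of the posterior means. -/
  Lμ : Fin m → Fin nExp → Ω → ℝ≥0
  /-- Lipschitz constants of the unknown function. -/
  Lf : Fin m → Ω → ℝ≥0

namespace GPModel

variable {Ω : Type*} {m : ℕ} {ι : Type*} [Fintype ι] (D : GPModel Ω m ι)

/-- The training outputs `y = f(X) + noise` of an expert. -/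
def output (f : Ω → EuclideanSpace ℝ ι → Vec m) (j : Fin m) (i : Fin D.nExp) (ω : Ω) :
    Fin (D.size j i) → ℝ :=
  fun s => f ω (D.input j i s) j + D.noise j i s ω

/-- The posterior mean `μᵢ` of an expert. -/
def expertMean (f : Ω → EuclideanSpace ℝ ι → Vec m) (j : Fin m) (i : Fin D.nExp) (ω : Ω)
    (ξ : EuclideanSpace ℝ ι) : ℝ :=
  postMean (D.κ j) (D.σn j) (D.input j i) (D.output f j i ω) ξ

/-- The posterior standard deviation `σᵢ` of an expert. -/
def expertStd (j : Fin m) (i : Fin D.nExp) (ξ : EuclideanSpace ℝ ι) : ℝ :=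
  postStd (D.κ j) (D.σn j) (D.input j i) ξ

/-- The aggregated prediction `∑ᵢ ωᵢ(ξ) μᵢ(ξ)` of every output. -/
def mean (f : Ω → EuclideanSpace ℝ ι → Vec m) (ω : Ω) (ξ : EuclideanSpace ℝ ι) : Vec m :=
  WithLp.toLp 2 (fun j => ∑ i, D.weight j i ω ξ * D.expertMean f j i ω ξ)

/-- The prediction error bound `ηⱼ(ξ) = β ∑ᵢ ωᵢ(ξ) σᵢ(ξ) + ∑ᵢ ωᵢ(ξ) γᵢ` with `β = 2 √β_δ` and
`γᵢ = (√β_δ Lσᵢ + Lf + Lμᵢ) τ`, where the level `δ` is shared equally among the experts. -/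
def errorBound (δ : ℝ) (ω : Ω) (ξ : EuclideanSpace ℝ ι) : Vec m :=
  let s := Real.sqrt (betaDelta D.lo D.hi D.τ (δ / D.nExp))
  WithLp.toLp 2 (fun j =>
    2 * s * (∑ i, D.weight j i ω ξ * D.expertStd j i ξ)
      + ∑ i, D.weight j i ω ξ * ((s * D.Lσ j i + D.Lf j ω + D.Lμ j i ω) * D.τ))

/-- Standing assumptions of Gaussian process regression: on the box, each output `fⱼ` is a sample
of a centred Gaussian process with covariance kernel `κⱼ`; the noise of each expert is i.i.d.
centred Gaussian and independent of `fⱼ`; the weights are nonnegative and normalized; the Lipschitz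
constants are what their names say. -/
structure IsRegression [MeasurableSpace Ω] (P : Measure Ω)
    (f : Ω → EuclideanSpace ℝ ι → Vec m) : Prop where
  gaussian : ∀ j, IsGaussianProcess (fun (ξ : box D.lo D.hi) ω => f ω ξ j) P
  centred : ∀ j, ∀ ξ ∈ box D.lo D.hi, ∫ ω, f ω ξ j ∂P = 0
  covariance : ∀ j, ∀ ξ ∈ box D.lo D.hi, ∀ ξ' ∈ box D.lo D.hi,
    cov[fun ω => f ω ξ j, fun ω => f ω ξ' j; P] = D.κ j ξ ξ'
  σn_pos : ∀ j, 0 < D.σn j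
  input_mem : ∀ j i s, D.input j i s ∈ box D.lo D.hi
  noise_law : ∀ j i s, P.map (D.noise j i s) = gaussianReal 0 (Real.toNNReal (D.σn j ^ 2))
  noise_indep : ∀ j i, iIndepFun (D.noise j i) P
  noise_indep_f : ∀ j i, IndepFun (fun ω (ξ : box D.lo D.hi) => f ω ξ j)
    (fun ω s => D.noise j i s ω) P
  weight_nonneg : ∀ j i ω, ∀ ξ ∈ box D.lo D.hi, 0 ≤ D.weight j i ω ξ
  weight_sum : ∀ j ω, ∀ ξ ∈ box D.lo D.hi, ∑ i, D.weight j i ω ξ = 1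
  τ_pos : 0 < D.τ
  lipschitz_std : ∀ j i, LipschitzOnWith (D.Lσ j i) (D.expertStd j i) (box D.lo D.hi)
  lipschitz_mean : ∀ j i ω, LipschitzOnWith (D.Lμ j i ω) (D.expertMean f j i ω) (box D.lo D.hi)
  lipschitz_f : ∀ j ω, LipschitzOnWith (D.Lf j ω) (fun ξ => f ω ξ j) (box D.lo D.hi)

end GPModel

end

/-! Along a closed-loop trajectory let `W t = V t (h t (x t))` and let `G` be the gradient in `x`.
Replacing `f` by `μ + (f - μ)` in the derivative of `W` costs at most `‖G‖ * ‖η‖ ≤ ‖G‖ ^ 2 / (4 * ε)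
+ ε * ‖η‖ ^ 2`, and the Lyapunov condition pays for the first term. Hence `W' ≤ -α(W) + ε η̄²`, so
`W` enters and never leaves `[0, r]` for every `r` with `α r > ε η̄²` (`eventually_le_of_deriv_le`),
and `αlo ‖z‖ ≤ W` gives the bound on `z`. This is pathwise on the event where all `m` component
bounds hold; a union bound gives its probability.

For Gaussian processes, the error of an expert at a fixed point is a linear combination of jointly
Gaussian variables. It is centred with the posterior variance (`map_sub_postMean_eq_gaussianReal`),
without any conditioning. The tail `exp (-s²/2)` at `s = √β_δ` is summed over experts and the points
of a `τ`-net of the box; `β_δ` makes the sum at most `δ`. Lipschitz continuity carries the bound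
from the net to the box, and convexity of the weights carries it to the aggregate
(`abs_sub_mean_le`). -/

/-! ### Probability bounds for possibly non-measurable events. -/

theorem HoldsWithProb.mono {Ω : Type*} [MeasurableSpace Ω] {P : Measure Ω} {p : ℝ} {S T : Set Ω}
    (h : HoldsWithProb P p S) (hST : S ⊆ T) : HoldsWithProb P p T := by
  obtain ⟨E, hE, hES, hp⟩ := h
  exact ⟨E, hE, hES.trans hST, hp⟩

/-- The measurable hull of `Sᶜ` has the same outer measure, and its complement is a measurable event
inside `S`. Union bounds can thus be made with outer measures of complements. -/
theorem holdsWithProb_of_measure_compl_le {Ω : Type*} [MeasurableSpace Ω] {P : Measure Ω}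
    [IsProbabilityMeasure P] {q : ℝ} {S : Set Ω} (h : P Sᶜ ≤ ENNReal.ofReal q) (hq : 0 ≤ q) :
    HoldsWithProb P (1 - q) S := by
  refine ⟨(toMeasurable P Sᶜ)ᶜ, (measurableSet_toMeasurable P _).compl, ?_, ?_⟩
  · rw [compl_subset_comm]
    exact subset_toMeasurable P _
  · rw [prob_compl_eq_one_sub (measurableSet_toMeasurable P _), measure_toMeasurable,
      ENNReal.ofReal_sub _ hq, ENNReal.ofReal_one]
    exact tsub_le_tsub_left h 1

theorem HoldsWithProb.measure_compl_le {Ω : Type*} [MeasurableSpace Ω] {P : Measure Ω}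
    [IsProbabilityMeasure P] {q : ℝ} {S : Set Ω} (h : HoldsWithProb P (1 - q) S) :
    P Sᶜ ≤ ENNReal.ofReal q := by
  obtain ⟨E, hE, hES, hp⟩ := h
  refine (measure_mono (compl_subset_compl.2 hES)).trans ?_
  rw [prob_compl_eq_one_sub hE, tsub_le_iff_left, ← ENNReal.ofReal_one]
  calc ENNReal.ofReal 1 = ENNReal.ofReal ((1 - q) + q) := by ring_nf
    _ ≤ ENNReal.ofReal (1 - q) + ENNReal.ofReal q := ENNReal.ofReal_add_le
    _ ≤ P E + ENNReal.ofReal q := by gcongr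

theorem holdsWithProb_iInter {Ω : Type*} [MeasurableSpace Ω] {P : Measure Ω}
    [IsProbabilityMeasure P] {m : ℕ} {δ : ℝ} (hδ : 0 ≤ δ) {S : Fin m → Set Ω}
    (h : ∀ j, HoldsWithProb P (1 - δ) (S j)) : HoldsWithProb P (1 - m * δ) (⋂ j, S j) := by
  refine holdsWithProb_of_measure_compl_le ?_ (by positivity)
  rw [compl_iInter]
  refine (measure_iUnion_fintype_le P _).trans ?_
  refine (Finset.sum_le_sum fun j _ => (h j).measure_compl_le).trans ?_
  simp [ENNReal.ofReal_mul]

/-! ### Ultimate boundedness from the Lyapunov condition. -/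

theorem lt_of_classKInv_lt {α : ℝ → ℝ} {s : ℝ≥0∞} {r : ℝ} (hr : 0 ≤ r)
    (h : classKInv α s < ENNReal.ofReal r) : s < ENNReal.ofReal (α r) := by
  by_contra! hs
  exact h.not_ge (le_sSup ⟨r, hr, hs, rfl⟩)

/-- Ultimate boundedness of a nonnegative function that decreases along its level sets. -/
theorem eventually_le_of_deriv_le {W W' α : ℝ → ℝ} (hα : IsClassK α) {c r : ℝ} (hr : 0 ≤ r)
    (hc : c < α r) (hW : ∀ t, 0 ≤ t → 0 ≤ W t)
    (hd : ∀ t, 0 ≤ t → HasDerivWithinAt W (W' t) (Ici 0) t)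
    (hb : ∀ t, 0 ≤ t → W' t ≤ - α (W t) + c) : ∀ᶠ t in atTop, W t ≤ r := by
  have hcont : ContinuousOn W (Ici 0) := fun t ht => (hd t ht).continuousWithinAt
  obtain ⟨T, hT0, hT⟩ : ∃ T, 0 ≤ T ∧ W T ≤ r := by
    by_contra! hcon
    -- While `W > r`, monotonicity of `α` makes `W` fall at rate at least `α r - c`.
    have hanti : AntitoneOn (fun t => W t + (α r - c) * t) (Ici 0) := by
      have hdi : ∀ t ∈ interior (Ici (0 : ℝ)),
          HasDerivAt (fun t => W t + (α r - c) * t) (W' t + (α r - c)) t := by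
        intro t ht
        rw [interior_Ici, mem_Ioi] at ht
        have h1 := (hd t ht.le).hasDerivAt (Ici_mem_nhds ht)
        exact (h1.add ((hasDerivAt_id t).const_mul (α r - c))).congr_deriv (by simp)
      refine antitoneOn_of_deriv_nonpos (convex_Ici 0) (hcont.add (by fun_prop))
        (fun t ht => (hdi t ht).differentiableAt.differentiableWithinAt) fun t ht => ?_
      rw [(hdi t ht).deriv]
      have ht0 : 0 ≤ t := interior_subset ht
      have := hb t ht0
      have := hα.strictMonoOn.monotoneOn hr (hW t ht0) (hcon t ht0).le
      linarith
    have hpos : 0 < α r - c := sub_pos.2 hc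
    -- By this time the guaranteed decrease has used up all of `W 0`, so `W ≤ 0 ≤ r`.
    have ht0 : 0 ≤ W 0 / (α r - c) := div_nonneg (hW 0 le_rfl) hpos.le
    have h1 := hanti self_mem_Ici ht0 ht0
    have h2 := hcon _ ht0
    simp only [mul_zero, add_zero] at h1
    rw [mul_div_cancel₀ _ hpos.ne'] at h1
    linarith
  filter_upwards [eventually_ge_atTop T] with t ht
  -- The level `r` is a barrier: where `W = r`, the derivative is at most `-α r + c < 0`.
  refine image_le_of_deriv_right_lt_deriv_boundary (f := W) (f' := W') (a := T) (b := t)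
    (B := fun _ => r) (B' := fun _ => 0) (hcont.mono fun s hs => hT0.trans hs.1)
    (fun s hs => (hd s (hT0.trans hs.1)).mono (Ici_subset_Ici.2 (hT0.trans hs.1))) hT
    (fun s => hasDerivAt_const s r) (fun s hs hWs => ?_) (right_mem_Icc.2 ht)
  have := hb s (hT0.trans hs.1)
  rw [hWs] at this
  linarith

/-- The derivative of the Lyapunov function along a curve in the state space. -/
theorem hasDerivWithinAt_lyapunov {m mz : ℕ} {𝕏 : Set (Vec m)} {h : ℝ → Vec m → Vec mz}
    (hh : DifferentiableOn ℝ (fun p : ℝ × Vec m => h p.1 p.2) (Ici 0 ×ˢ 𝕏))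
    {V : ℝ → Vec mz → ℝ}
    (hV : DifferentiableOn ℝ (fun p : ℝ × Vec mz => V p.1 p.2) (Ici 0 ×ˢ univ))
    {x : ℝ → Vec m} {x' : Vec m} (hx : ∀ t, 0 ≤ t → x t ∈ 𝕏) {t : ℝ} (ht : 0 ≤ t)
    (hd : HasDerivWithinAt x x' (Ici 0) t) :
    HasDerivWithinAt (fun t => V t (h t (x t)))
      (gradX 𝕏 h V t (x t) x' + gradT 𝕏 h V t (x t)) (Ici 0) t := by
  have h1 : HasDerivWithinAt (fun s => (s, x s)) ((1 : ℝ), x') (Ici 0) t :=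
    (hasDerivWithinAt_id t _).prodMk hd
  -- As `𝕏` is arbitrary, derivatives within it need not be unique; the chain rule holds for the
  -- chosen one because the curve stays in the set.
  have h2 : HasDerivWithinAt (fun s => h s (x s)) (outputDeriv 𝕏 h t (x t) (1, x')) (Ici 0) t :=
    HasFDerivWithinAt.comp_hasDerivWithinAt (t := Ici 0 ×ˢ 𝕏)
      (l := fun p : ℝ × Vec m => h p.1 p.2) t (hh (t, x t) ⟨ht, hx t ht⟩).hasFDerivWithinAt h1
      fun s hs => mk_mem_prod hs (hx s hs)
  have h3 : HasDerivWithinAt (fun s => (s, h s (x s)))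
      ((1 : ℝ), outputDeriv 𝕏 h t (x t) (1, x')) (Ici 0) t :=
    (hasDerivWithinAt_id t _).prodMk h2
  have h4 := HasFDerivWithinAt.comp_hasDerivWithinAt (t := Ici 0 ×ˢ univ)
    (l := fun p : ℝ × Vec mz => V p.1 p.2) t
    (hV (t, h t (x t)) ⟨ht, mem_univ _⟩).hasFDerivWithinAt h3
      fun s hs => mk_mem_prod hs (mem_univ _)
  refine h4.congr_deriv ?_
  have e1 : ((1 : ℝ), x') = (0, x') + (1, 0) := by simp
  have e2 : ∀ v : Vec mz, ((1 : ℝ), v) = (1, 0) + (0, v) := by simp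
  rw [e2, map_add, e1, map_add]
  simp only [gradX, gradT, partialZ, ContinuousLinearMap.comp_apply, ContinuousLinearMap.inr_apply]
  rw [show ((0 : ℝ), outputDeriv 𝕏 h t (x t) (0, x') + outputDeriv 𝕏 h t (x t) (1, 0))
    = (0, outputDeriv 𝕏 h t (x t) (0, x')) + (0, outputDeriv 𝕏 h t (x t) (1, 0)) by simp, map_add]
  ring

/-- A model error that is bounded along the closed loop yields ultimate boundedness. -/
theorem outputUltimatelyBounded_of_norm_sub_le {m mu mz : ℕ} {𝕏 : Set (Vec m)} {𝕌 : Set (Vec mu)}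
    {f g μ η : StateInput m mu → Vec m} {h : ℝ → Vec m → Vec mz}
    (hh : DifferentiableOn ℝ (fun p : ℝ × Vec m => h p.1 p.2) (Ici 0 ×ˢ 𝕏))
    {𝓜 : Set (StateInput m mu → Vec m)} {π : ControlLaw m mu}
    {V : ℝ → Vec mz → ℝ} {αlo αhi α : ℝ → ℝ} {ε : ℝ}
    (hπ : ISSLyapunovCondition 𝕏 𝕌 g h 𝓜 π V αlo αhi α ε) (hμ : μ ∈ 𝓜)
    (hη : ∀ ξ ∈ jointDomain 𝕏 𝕌, ‖f ξ - μ ξ‖ ≤ ‖η ξ‖) :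
    OutputUltimatelyBounded 𝕏 𝕌 f g μ h π
      (classKInv αlo (classKInv α
        (ENNReal.ofReal ε * worstCaseError 𝕏 𝕌 π μ η ^ 2))) := by
  intro x hx
  set s := ENNReal.ofReal ε * worstCaseError 𝕏 𝕌 π μ η ^ 2 with hs
  refine le_of_forall_gt_imp_ge_of_dense fun b hb => ?_
  obtain ⟨q, hq, hqb⟩ := ENNReal.lt_iff_exists_nnreal_btwn.1 hb
  refine le_trans ?_ hqb.le
  have hlo : 0 ≤ αlo q := hπ.classK_lo.nonneg q.2
  -- Since `q` lies strictly above the claimed bound, both inverses unwind. In particular `s` is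
  -- finite, so the argument can continue in the reals.
  have hsr : s < ENNReal.ofReal (α (αlo q)) := by
    refine lt_of_classKInv_lt hlo (lt_of_classKInv_lt q.2 ?_)
    rwa [ENNReal.ofReal_coe_nnreal]
  have hc : s.toReal < α (αlo q) :=
    (ENNReal.lt_ofReal_iff_toReal_lt (ne_top_of_lt hsr)).1 hsr
  have hev := eventually_le_of_deriv_le (W := fun t => V t (h t (x t))) hπ.classK hlo hc
    (fun t ht => (hπ.classK_lo.nonneg (norm_nonneg _)).trans (hπ.lower t ht _))
    (fun t ht => hasDerivWithinAt_lyapunov hh hπ.differentiable (fun t ht => (hx t ht).1) ht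
      (hx t ht).2.2) ?_
  · refine limsup_le_of_le (by isBoundedDefault) ?_
    filter_upwards [hev, eventually_ge_atTop 0] with t ht ht0
    have h1 : ‖h t (x t)‖ ≤ q := (hπ.classK_lo.strictMonoOn.le_iff_le (norm_nonneg _) q.2).1
      ((hπ.lower t ht0 _).trans ht)
    rw [enorm_eq_nnnorm]
    exact_mod_cast h1
  · intro t ht
    obtain ⟨hxt, hut, -⟩ := hx t ht
    have hdec := hπ.decrease μ hμ t ht (x t) hxt hut
    set ξ := closedLoopInput π μ t (x t) with hξ
    set G := gradX 𝕏 h V t (x t) with hG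
    have hεη : ε * ‖η ξ‖ ^ 2 ≤ s.toReal := by
      rw [← ENNReal.ofReal_le_iff_le_toReal (ne_top_of_lt hsr), hs,
        ENNReal.ofReal_mul hπ.eps_pos.le, ENNReal.ofReal_pow (norm_nonneg _), ofReal_norm]
      gcongr
      exact le_iSup₂_of_le t ht (le_iSup₂_of_le (x t) hxt (le_iSup_of_le hut le_rfl))
    have he : ‖f ξ - μ ξ‖ ≤ ‖η ξ‖ := hη ξ ⟨x t, hxt, _, hut, rfl⟩
    have hGe : G (f ξ - μ ξ) ≤ ‖G‖ * ‖η ξ‖ :=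
      (le_abs_self _).trans ((G.le_opNorm _).trans (by gcongr))
    have hsplit : G (f ξ + g ξ) = G (μ ξ + g ξ) + G (f ξ - μ ξ) := by
      rw [← map_add]; congr 1; abel
    -- The first term on the right cancels against the damping term of the Lyapunov condition; the
    -- second is at most `s.toReal`.
    have hyoung : ‖G‖ * ‖η ξ‖ ≤ ‖G‖ ^ 2 / (4 * ε) + ε * ‖η ξ‖ ^ 2 := by
      have hε := hπ.eps_pos
      have : ‖G‖ ^ 2 / (4 * ε) + ε * ‖η ξ‖ ^ 2 - ‖G‖ * ‖η ξ‖
          = (‖G‖ - 2 * ε * ‖η ξ‖) ^ 2 / (4 * ε) := by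
        field_simp; ring
      have : 0 ≤ (‖G‖ - 2 * ε * ‖η ξ‖) ^ 2 / (4 * ε) := by positivity
      linarith
    rw [hsplit]
    linarith

theorem norm_le_norm_of_forall_abs_le {m : ℕ} {v w : Vec m} (h : ∀ j, |v j| ≤ w j) :
    ‖v‖ ≤ ‖w‖ := by
  rw [EuclideanSpace.norm_eq, EuclideanSpace.norm_eq]
  refine Real.sqrt_le_sqrt (Finset.sum_le_sum fun j _ => ?_)
  rw [Real.norm_eq_abs, Real.norm_eq_abs]
  exact pow_le_pow_left₀ (abs_nonneg _) ((h j).trans (le_abs_self _)) 2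

theorem holdsWithProb_outputUltimatelyBounded {m mu mz : ℕ} {Ω : Type*} [MeasurableSpace Ω]
    {P : Measure Ω} [IsProbabilityMeasure P] {𝕏 : Set (Vec m)} {𝕌 : Set (Vec mu)}
    {f : Ω → StateInput m mu → Vec m} {g : StateInput m mu → Vec m} {h : ℝ → Vec m → Vec mz}
    (hh : DifferentiableOn ℝ (fun p : ℝ × Vec m => h p.1 p.2) (Ici 0 ×ˢ 𝕏))
    {𝓜 : Set (StateInput m mu → Vec m)} {π : ControlLaw m mu}
    {V : ℝ → Vec mz → ℝ} {αlo αhi α : ℝ → ℝ} {ε : ℝ}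
    (hπ : ISSLyapunovCondition 𝕏 𝕌 g h 𝓜 π V αlo αhi α ε) {δ : ℝ} (hδ : 0 ≤ δ)
    {μ η : Ω → StateInput m mu → Vec m} (hμ : ∀ ω, μ ω ∈ 𝓜)
    (hη : ∀ j : Fin m, HoldsWithProb P (1 - δ)
      {ω | ∀ ξ ∈ jointDomain 𝕏 𝕌, |f ω ξ j - μ ω ξ j| ≤ η ω ξ j}) :
    HoldsWithProb P (1 - m * δ)
      {ω | OutputUltimatelyBounded 𝕏 𝕌 (f ω) g (μ ω) h π
        (classKInv αlo (classKInv α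
          (ENNReal.ofReal ε * worstCaseError 𝕏 𝕌 π (μ ω) (η ω) ^ 2)))} := by
  refine (holdsWithProb_iInter hδ hη).mono fun ω hω => ?_
  refine outputUltimatelyBounded_of_norm_sub_le hh hπ (hμ ω) fun ξ hξ =>
    norm_le_norm_of_forall_abs_le fun j => ?_
  simpa using mem_iInter.1 hω j ξ hξ

/-! ### Gaussian tails. -/

/-- The density at `x + a` is the density at `x` times `exp (-a²/(2v)) * exp (-a x/v)`, and `0 ≤ a *
x` bounds the last factor by one. -/
theorem gaussianReal_le_of_forall_add_mem {v : ℝ≥0} (hv : v ≠ 0) {A B : Set ℝ}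
    (hA : MeasurableSet A) (hB : MeasurableSet B) {a : ℝ}
    (h : ∀ x, x + a ∈ A → x ∈ B ∧ 0 ≤ a * x) :
    gaussianReal 0 v A ≤ ENNReal.ofReal (Real.exp (-(a ^ 2 / (2 * v)))) * gaussianReal 0 v B := by
  rw [gaussianReal_apply _ hv, gaussianReal_apply _ hv, ← lintegral_indicator hA,
    ← lintegral_indicator hB, ← lintegral_add_right_eq_self _ a,
    ← lintegral_const_mul' _ _ ENNReal.ofReal_ne_top]
  refine lintegral_mono fun x => ?_
  by_cases hx : x + a ∈ A
  · obtain ⟨hxB, hax⟩ := h x hx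
    rw [indicator_of_mem hx, indicator_of_mem hxB, gaussianPDF, gaussianPDF,
      ← ENNReal.ofReal_mul (Real.exp_pos _).le]
    refine ENNReal.ofReal_le_ofReal ?_
    rw [gaussianPDFReal, gaussianPDFReal, mul_left_comm, ← Real.exp_add]
    have hv' : (0 : ℝ) < v := by positivity
    gcongr
    rw [← sub_nonneg]
    have : -(a ^ 2 / (2 * (v : ℝ))) + -(x - 0) ^ 2 / (2 * v) - -(x + a - 0) ^ 2 / (2 * v)
      = a * x / v := by field_simp; ring
    rw [this]
    positivity
  · rw [indicator_of_notMem hx]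
    exact zero_le

/-- The two-sided Gaussian tail bound without a prefactor. -/
theorem gaussianReal_abs_gt_le (v : ℝ≥0) {s : ℝ} (hs : 0 ≤ s) :
    gaussianReal 0 v {x | s * Real.sqrt v < |x|} ≤ ENNReal.ofReal (Real.exp (-(s ^ 2 / 2))) := by
  rcases eq_or_ne v 0 with rfl | hv
  · rw [gaussianReal_zero_var, Measure.dirac_apply' _ (by measurability)]
    simp
  have hv' : (0 : ℝ) < v := by positivity
  set r := s * Real.sqrt v with hr
  have hr0 : 0 ≤ r := by positivity
  have hrs : r ^ 2 / (2 * v) = s ^ 2 / 2 := by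
    rw [hr, mul_pow, Real.sq_sqrt hv'.le]
    field_simp
  have h1 := gaussianReal_le_of_forall_add_mem hv (A := Ioi r) (B := Ioi 0) measurableSet_Ioi
    measurableSet_Ioi (a := r) fun x hx => by
      have : 0 < x := by simpa using hx
      exact ⟨this, by positivity⟩
  have h2 := gaussianReal_le_of_forall_add_mem hv (A := Iio (-r)) (B := Iio 0) measurableSet_Iio
    measurableSet_Iio (a := -r) fun x hx => by
      have : x < 0 := by simpa using hx
      exact ⟨this, mul_nonneg_of_nonpos_of_nonpos (by linarith) this.le⟩
  rw [neg_sq, hrs] at h2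
  rw [hrs] at h1
  have hset : {x : ℝ | r < |x|} = Ioi r ∪ Iio (-r) := by
    ext x
    simp [lt_abs, lt_neg]
  rw [hset]
  refine (measure_union_le _ _).trans ((add_le_add h1 h2).trans ?_)
  -- Each tail was compared with its own half-line; these are disjoint, so no factor 2 appears.
  rw [← mul_add, ← measure_union (Ioi_disjoint_Iio_same (a := (0 : ℝ)))
    measurableSet_Iio]
  exact mul_le_of_le_one_right zero_le prob_le_one

/-! ### The law of the posterior error. -/

section Regression

variable {Ω : Type*} [MeasurableSpace Ω] {P : Measure Ω} [IsProbabilityMeasure P]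

theorem map_sub_sum_eq_gaussianReal {T : Type*} {F : T → Ω → ℝ}
    (hF : IsGaussianProcess F P) (hmean : ∀ t, ∫ ω, F t ω ∂P = 0) {N : ℕ} {E : Fin N → Ω → ℝ}
    {v : ℝ≥0} (hE : ∀ s, P.map (E s) = gaussianReal 0 v) (hEi : iIndepFun E P)
    (hFE : IndepFun (fun ω t => F t ω) (fun ω s => E s ω) P) (a : T) (x : Fin N → T)
    (w : Fin N → ℝ) :
    P.map (fun ω => F a ω - ∑ s, w s * (F (x s) ω + E s ω))
      = gaussianReal 0 (cov[F a, F a; P] - 2 * ∑ s, w s * cov[F a, F (x s); P]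
          + ∑ s, ∑ t, w s * w t * cov[F (x s), F (x t); P] + v * ∑ s, w s ^ 2).toNNReal := by
  have hU : HasGaussianLaw (fun ω => F a ω - ∑ s, w s * F (x s) ω) P := by
    -- The index `none` stands for the test point, with coefficient 1, and `some s` for the training
    -- points, with coefficients `-w s`.
    have h1 := ((hF.comp_right (fun o : Option (Fin N) => o.elim a x)).smul
      (fun o => o.elim 1 fun s => - w s)).hasGaussianLaw_fun_sum (I := Finset.univ)
    convert! h1 using 2 with ω
    simp [Fintype.sum_option, sub_eq_add_neg]
  have hEg : ∀ s, HasGaussianLaw (E s) P := fun s => ⟨by rw [hE s]; infer_instance⟩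
  have hR : HasGaussianLaw (fun ω => ∑ s, w s * E s ω) P := by
    have h1 := (hEi.hasGaussianLaw hEg).map (∑ s, w s • ContinuousLinearMap.proj s)
    convert! h1 using 2 with ω
    simp
  have hUR : IndepFun (fun ω => F a ω - ∑ s, w s * F (x s) ω) (fun ω => ∑ s, w s * E s ω) P :=
    hFE.comp (φ := fun g : T → ℝ => g a - ∑ s, w s * g (x s))
      (ψ := fun e : Fin N → ℝ => ∑ s, w s * e s)
      (by fun_prop) (by fun_prop)
  have hFL : ∀ t, MemLp (F t) 2 P := fun t => (hF.hasGaussianLaw_eval t).memLp_two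
  have hEm : ∀ s, ∫ ω, E s ω ∂P = 0 := fun s => by
    have := integral_map (hEg s).aemeasurable (f := id) (by fun_prop)
    rw [hE s] at this
    simpa using this.symm
  have hEv : ∀ s, Var[E s; P] = v := fun s => by
    have h1 := variance_map (X := id) (by fun_prop) (hEg s).aemeasurable
    rw [hE s, variance_id_gaussianReal] at h1
    exact h1.symm
  have hVR : Var[fun ω => ∑ s, w s * E s ω; P] = v * ∑ s, w s ^ 2 := by
    have h1 := IndepFun.variance_sum (μ := P) (X := fun s ω => w s * E s ω) (s := Finset.univ)
      (fun s _ => ((hEg s).memLp_two).const_mul (w s)) fun s _ t _ hst =>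
        (hEi.indepFun hst).comp (φ := fun e => w s * e) (ψ := fun e => w t * e)
          (by fun_prop) (by fun_prop)
    rw [Finset.sum_fn] at h1
    rw [h1, Finset.mul_sum]
    refine Finset.sum_congr rfl fun s _ => ?_
    rw [variance_const_mul, hEv]
    ring
  have hwF : ∀ s, MemLp (fun ω => w s * F (x s) ω) 2 P := fun s => (hFL _).const_mul _
  have hS : MemLp (fun ω => ∑ s, w s * F (x s) ω) 2 P := memLp_finsetSum _ fun s _ => hwF s
  have hVU : Var[fun ω => F a ω - ∑ s, w s * F (x s) ω; P] =
      cov[F a, F a; P] - 2 * ∑ s, w s * cov[F a, F (x s); P]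
          + ∑ s, ∑ t, w s * w t * cov[F (x s), F (x t); P] := by
    have hc : cov[F a, fun ω => ∑ s, w s * F (x s) ω; P] = ∑ s, w s * cov[F a, F (x s); P] := by
      rw [covariance_fun_sum_right hwF (hFL a)]
      simp_rw [covariance_const_mul_right]
    rw [variance_fun_sub (hFL a) hS, ← covariance_self (hFL a).aemeasurable, hc,
      ← covariance_self hS.aemeasurable, covariance_fun_sum_fun_sum hwF hwF]
    simp_rw [covariance_const_mul_right, covariance_const_mul_left]
    congr 1
    refine Finset.sum_congr rfl fun s _ => Finset.sum_congr rfl fun t _ => ?_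
    ring
  have heq : (fun ω => F a ω - ∑ s, w s * (F (x s) ω + E s ω))
      = fun ω => (F a ω - ∑ s, w s * F (x s) ω) - ∑ s, w s * E s ω := by
    funext ω
    simp only [mul_add, Finset.sum_add_distrib]
    ring
  rw [heq, (hUR.hasGaussianLaw hU hR).fun_sub.map_eq_gaussianReal]
  congr 2
  · rw [integral_sub hU.integrable hR.integrable,
      integral_sub (hF.hasGaussianLaw_eval a).integrable (hS.integrable one_le_two),
      integral_finsetSum _ fun s _ => (hwF s).integrable one_le_two,
      integral_finsetSum _ fun s _ => ((hEg s).integrable).const_mul _]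
    simp [integral_const_mul, hmean, hEm]
  · rw [variance_fun_sub hU.memLp_two hR.memLp_two,
      hUR.covariance_eq_zero hU.memLp_two hR.memLp_two, hVU, hVR]
    ring

/-- The quadratic form at `w` is the variance of `∑ s, w s * F (x s)`. -/
theorem posSemidef_covariance {T : Type*} {F : T → Ω → ℝ} (hF : IsGaussianProcess F P) {N : ℕ}
    (x : Fin N → T) :
    (Matrix.of fun s t => cov[F (x s), F (x t); P] : Matrix (Fin N) (Fin N) ℝ).PosSemidef := by
  have hFL : ∀ t, MemLp (F t) 2 P := fun t => (hF.hasGaussianLaw_eval t).memLp_two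
  refine Matrix.PosSemidef.of_dotProduct_mulVec_nonneg ?_ fun w => ?_
  · ext s t
    simp [covariance_comm (F (x t))]
  · have hwF : ∀ s, MemLp (fun ω => w s * F (x s) ω) 2 P := fun s => (hFL _).const_mul _
    have hS : MemLp (fun ω => ∑ s, w s * F (x s) ω) 2 P := memLp_finsetSum _ fun s _ => hwF s
    have h0 := variance_nonneg (fun ω => ∑ s, w s * F (x s) ω) P
    rw [← covariance_self hS.aemeasurable, covariance_fun_sum_fun_sum hwF hwF] at h0
    simp_rw [covariance_const_mul_right, covariance_const_mul_left] at h0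
    refine h0.trans_eq ?_
    simp only [dotProduct, Matrix.mulVec, Finset.mul_sum, star_trivial, Matrix.of_apply]
    refine Finset.sum_congr rfl fun s _ => Finset.sum_congr rfl fun t _ => ?_
    ring

/-- The error of the posterior mean is centred Gaussian, and its variance is the posterior
variance. -/
theorem map_sub_postMean_eq_gaussianReal {ι : Type*} [Fintype ι] {B : Set (EuclideanSpace ℝ ι)}
    {F : Ω → EuclideanSpace ℝ ι → ℝ} {κ : EuclideanSpace ℝ ι → EuclideanSpace ℝ ι → ℝ}
    (hF : IsGaussianProcess (fun (ξ : B) ω => F ω ξ) P)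
    (hmean : ∀ ξ ∈ B, ∫ ω, F ω ξ ∂P = 0)
    (hcov : ∀ ξ ∈ B, ∀ ξ' ∈ B, cov[fun ω => F ω ξ, fun ω => F ω ξ'; P] = κ ξ ξ')
    {σn : ℝ} (hσ : 0 < σn) {N : ℕ} {E : Fin N → Ω → ℝ}
    (hE : ∀ s, P.map (E s) = gaussianReal 0 (σn ^ 2).toNNReal) (hEi : iIndepFun E P)
    (hFE : IndepFun (fun ω (ξ : B) => F ω ξ) (fun ω s => E s ω) P)
    {X : Fin N → EuclideanSpace ℝ ι} (hX : ∀ s, X s ∈ B) {ξ : EuclideanSpace ℝ ι} (hξ : ξ ∈ B) :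
    P.map (fun ω => F ω ξ - postMean κ σn X (fun s => F ω (X s) + E s ω) ξ)
      = gaussianReal 0 (κ ξ ξ -
    (fun s => κ ξ (X s)) ⬝ᵥ ((noisyGram κ σn X)⁻¹ *ᵥ (fun s => κ ξ (X s)))).toNNReal := by
  have hgram : (noisyGram κ σn X).PosDef := by
    have h1 := posSemidef_covariance hF (fun s => (⟨X s, hX s⟩ : B))
    have h2 : (Matrix.of fun s t => κ (X s) (X t) : Matrix (Fin N) (Fin N) ℝ).PosSemidef := by
      convert h1 using 1
      ext s t
      exact (hcov _ (hX s) _ (hX t)).symm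
    exact Matrix.PosDef.posSemidef_add h2 (Matrix.PosDef.one.smul (by positivity))
  set A := noisyGram κ σn X with hA
  set k : Fin N → ℝ := fun s => κ ξ (X s) with hk
  -- These are the coefficients of the posterior mean. As `A w = k`, the variance `κ ξ ξ - 2 w·k +
  -- w·A w` collapses to `κ ξ ξ - w·k`.
  set w := A⁻¹ *ᵥ k with hw
  have hAw : A *ᵥ w = k := by
    rw [hw, Matrix.mulVec_mulVec, Matrix.mul_nonsing_inv _ ((Matrix.isUnit_iff_isUnit_det A).1
      hgram.isUnit), Matrix.one_mulVec]
  have hsymm : A⁻¹ᵀ = A⁻¹ := by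
    have := hgram.isHermitian.inv
    rwa [Matrix.IsHermitian, Matrix.conjTranspose_eq_transpose_of_trivial] at this
  have hpm : ∀ y, postMean κ σn X y ξ = ∑ s, w s * y s := fun y => by
    rw [postMean, ← hA, ← hk, Matrix.dotProduct_mulVec, ← Matrix.mulVec_transpose, hsymm]
    rfl
  simp_rw [hpm]
  have h1 := map_sub_sum_eq_gaussianReal hF (fun t => hmean t t.2) hE hEi hFE ⟨ξ, hξ⟩
    (fun s => ⟨X s, hX s⟩) w
  simp only [hcov _ hξ _ hξ, hcov _ hξ _ (hX _), hcov _ (hX _) _ (hX _)] at h1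
  rw [h1]
  congr 2
  have hq : ∑ s, ∑ t, w s * w t * κ (X s) (X t) + ((σn ^ 2).toNNReal : ℝ) * ∑ s, w s ^ 2
      = w ⬝ᵥ k := by
    rw [← hAw, hA, noisyGram, Matrix.add_mulVec, Matrix.smul_mulVec, Matrix.one_mulVec,
      dotProduct_add, dotProduct_smul, Real.coe_toNNReal _ (sq_nonneg _), smul_eq_mul]
    congr 1
    · simp only [dotProduct, Matrix.mulVec, Finset.mul_sum, Matrix.of_apply]
      refine Finset.sum_congr rfl fun s _ => Finset.sum_congr rfl fun t _ => ?_
      ring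
    · simp [dotProduct, sq]
  have hq2 : ∑ s, w s * κ ξ (X s) = w ⬝ᵥ k := rfl
  rw [add_assoc, hq, hq2, dotProduct_comm k w]
  ring

theorem measure_abs_sub_postMean_gt_le {ι : Type*} [Fintype ι] {B : Set (EuclideanSpace ℝ ι)}
    {F : Ω → EuclideanSpace ℝ ι → ℝ} {κ : EuclideanSpace ℝ ι → EuclideanSpace ℝ ι → ℝ}
    (hF : IsGaussianProcess (fun (ξ : B) ω => F ω ξ) P)
    (hmean : ∀ ξ ∈ B, ∫ ω, F ω ξ ∂P = 0)
    (hcov : ∀ ξ ∈ B, ∀ ξ' ∈ B, cov[fun ω => F ω ξ, fun ω => F ω ξ'; P] = κ ξ ξ')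
    {σn : ℝ} (hσ : 0 < σn) {N : ℕ} {E : Fin N → Ω → ℝ}
    (hE : ∀ s, P.map (E s) = gaussianReal 0 (σn ^ 2).toNNReal) (hEi : iIndepFun E P)
    (hFE : IndepFun (fun ω (ξ : B) => F ω ξ) (fun ω s => E s ω) P)
    {X : Fin N → EuclideanSpace ℝ ι} (hX : ∀ s, X s ∈ B) {ξ : EuclideanSpace ℝ ι} (hξ : ξ ∈ B)
    {s : ℝ} (hs : 0 ≤ s) :
    P {ω | s * postStd κ σn X ξ < |F ω ξ - postMean κ σn X (fun i => F ω (X i) + E i ω) ξ|}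
      ≤ ENNReal.ofReal (Real.exp (-(s ^ 2 / 2))) := by
  have h1 := map_sub_postMean_eq_gaussianReal hF hmean hcov hσ hE hEi hFE hX hξ
  -- A map that is not a.e. measurable has pushforward zero, whereas this pushforward is a
  -- probability measure.
  have hm : AEMeasurable (fun ω => F ω ξ - postMean κ σn X (fun s => F ω (X s) + E s ω) ξ) P :=
    AEMeasurable.of_map_ne_zero (by rw [h1]; exact IsProbabilityMeasure.ne_zero _)
  have h2 := gaussianReal_abs_gt_le (κ ξ ξ - (fun s => κ ξ (X s)) ⬝ᵥ
    ((noisyGram κ σn X)⁻¹ *ᵥ (fun s => κ ξ (X s)))).toNNReal hs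
  rw [← h1, Measure.map_apply_of_aemeasurable hm
    (measurableSet_lt measurable_const (measurable_id'.abs))] at h2
  -- `Real.sqrt` truncates at zero through `Real.toNNReal`, just as the variance above does.
  rw [postStd, Real.sqrt]
  rw [Real.sqrt, Real.toNNReal_coe] at h2
  exact h2

end Regression

/-! ### Nets of a box and the constant `β_δ`. -/

theorem exists_grid_Icc {lo hi ρ : ℝ} {N : ℕ} (hlh : lo ≤ hi) (hN : 0 < N)
    (h : hi - lo ≤ 2 * ρ * N) :
    ∃ c : Fin N → ℝ, (∀ i, lo ≤ c i ∧ c i ≤ hi) ∧ ∀ x, lo ≤ x → x ≤ hi → ∃ i, |x - c i| ≤ ρ := by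
  have hN' : (0 : ℝ) < N := by exact_mod_cast hN
  set d := (hi - lo) / N with hd
  have hdN : d * N = hi - lo := by rw [hd]; field_simp
  have hd0 : 0 ≤ d := div_nonneg (sub_nonneg.2 hlh) hN'.le
  have hdρ : d ≤ 2 * ρ := by rwa [hd, div_le_iff₀ hN']
  refine ⟨fun i => lo + (i + 1 / 2) * d, fun i => ?_, fun x hx hx' => ?_⟩
  · have hi' : ((i : ℕ) : ℝ) + 1 ≤ N := by exact_mod_cast i.2
    constructor
    · have : 0 ≤ ((i : ℕ) + 1 / 2 : ℝ) * d := by positivity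
      linarith
    · have : ((i : ℕ) + 1 / 2 : ℝ) * d ≤ N * d := by gcongr; linarith
      linarith
  · have hex : ∃ k : ℕ, x - lo ≤ (k + 1) * d :=
      ⟨N, by nlinarith⟩
    classical
    -- The points `c i` are centres of `N` cells of length `d ≤ 2ρ`; `k` is the first cell whose
    -- right end reaches `x`, which also covers `d = 0`.
    set k := Nat.find hex with hk
    have hk1 : x - lo ≤ (k + 1) * d := Nat.find_spec hex
    have hkN : k < N := by
      have : k ≤ N - 1 := Nat.find_min' hex (by
        rw [Nat.cast_sub hN]
        push_cast
        nlinarith)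
      omega
    have hk2 : k * d ≤ x - lo := by
      rcases Nat.eq_zero_or_pos k with h0 | h0
      · rw [h0]; simpa using hx
      · have h1 := Nat.find_min hex (m := k - 1) (by omega)
        rw [Nat.cast_sub h0] at h1
        push_cast at h1
        linarith
    refine ⟨⟨k, hkN⟩, abs_le.2 ⟨?_, ?_⟩⟩ <;> dsimp only <;> nlinarith

/-- The number of cells of length at most `2 τ / √n` along the edge `k` of a box. -/
noncomputable def gridSize {ι : Type*} [Fintype ι] (lo hi : ι → ℝ) (τ : ℝ) (k : ι) : ℕ :=
  (max 1 ⌈Real.sqrt (Fintype.card ι) / (2 * τ) * (hi k - lo k)⌉ : ℤ).toNat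

theorem gridSize_cast {ι : Type*} [Fintype ι] (lo hi : ι → ℝ) (τ : ℝ) (k : ι) :
    (gridSize lo hi τ k : ℤ)
      = max 1 ⌈Real.sqrt (Fintype.card ι) / (2 * τ) * (hi k - lo k)⌉ :=
  Int.toNat_of_nonneg (zero_le_one.trans (le_max_left _ _))

theorem gridSize_pos {ι : Type*} [Fintype ι] (lo hi : ι → ℝ) (τ : ℝ) (k : ι) :
    0 < gridSize lo hi τ k := by
  have : (1 : ℤ) ≤ gridSize lo hi τ k := by rw [gridSize_cast]; exact le_max_left _ _
  omega

/-- A box has a `τ`-net with `∏ₖ gridSize lo hi τ k` points. -/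
theorem exists_grid_box {ι : Type*} [Fintype ι] [Nonempty ι] {lo hi : ι → ℝ} {τ : ℝ} (hτ : 0 < τ)
    (hlh : ∀ k, lo k ≤ hi k) :
    ∃ p : (∀ k, Fin (gridSize lo hi τ k)) → EuclideanSpace ℝ ι,
      (∀ c, p c ∈ box lo hi) ∧ ∀ ξ ∈ box lo hi, ∃ c, dist ξ (p c) ≤ τ := by
  have hn : 0 < Real.sqrt (Fintype.card ι) := Real.sqrt_pos.2 (by exact_mod_cast Fintype.card_pos)
  -- Half a cell is at most `τ / √n` in each of the `n` coordinates, hence at most `τ` in Euclidean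
  -- distance.
  have hside : ∀ k, hi k - lo k ≤ 2 * (τ / Real.sqrt (Fintype.card ι)) * gridSize lo hi τ k := by
    intro k
    have h1 : Real.sqrt (Fintype.card ι) / (2 * τ) * (hi k - lo k) ≤ gridSize lo hi τ k := by
      refine (Int.le_ceil _).trans ?_
      have : ⌈Real.sqrt (Fintype.card ι) / (2 * τ) * (hi k - lo k)⌉ ≤ (gridSize lo hi τ k : ℤ) := by
        rw [gridSize_cast]; exact le_max_right _ _
      exact_mod_cast this
    calc hi k - lo k = 2 * (τ / Real.sqrt (Fintype.card ι))
          * (Real.sqrt (Fintype.card ι) / (2 * τ) * (hi k - lo k)) := by field_simp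
      _ ≤ _ := by gcongr
  choose c hc hcov using fun k => exists_grid_Icc (hlh k) (gridSize_pos lo hi τ k) (hside k)
  refine ⟨fun e => WithLp.toLp 2 fun k => c k (e k), fun e k => hc k (e k), fun ξ hξ => ?_⟩
  choose e he using fun k => hcov k (ξ k) (hξ k).1 (hξ k).2
  refine ⟨e, ?_⟩
  rw [EuclideanSpace.dist_eq]
  refine Real.sqrt_le_iff.2 ⟨hτ.le, ?_⟩
  calc ∑ k, dist (ξ k) (c k (e k)) ^ 2
      ≤ ∑ _k : ι, (τ / Real.sqrt (Fintype.card ι)) ^ 2 := by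
        refine Finset.sum_le_sum fun k _ => ?_
        rw [Real.dist_eq]
        exact pow_le_pow_left₀ (abs_nonneg _) (he k) 2
    _ = τ ^ 2 := by
        rw [Finset.sum_const, Finset.card_univ, nsmul_eq_mul, div_pow,
          Real.sq_sqrt (Nat.cast_nonneg _)]
        have : (Fintype.card ι : ℝ) ≠ 0 := by exact_mod_cast Fintype.card_ne_zero
        field_simp

theorem betaDelta_eq {ι : Type*} [Fintype ι] (lo hi : ι → ℝ) (τ δ : ℝ) :
    betaDelta lo hi τ δ = 2 * Real.log (∏ k, (gridSize lo hi τ k : ℝ))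
      - 2 * Real.log (δ / Fintype.card ι) := by
  rw [betaDelta, Real.log_prod fun k _ => by exact_mod_cast (gridSize_pos lo hi τ k).ne']
  simp_rw [← gridSize_cast, Int.cast_natCast]

theorem betaDelta_nonneg {ι : Type*} [Fintype ι] [Nonempty ι] (lo hi : ι → ℝ) (τ : ℝ) {δ : ℝ}
    (hδ : 0 < δ) (hδ1 : δ ≤ 1) : 0 ≤ betaDelta lo hi τ δ := by
  have h1 : 0 ≤ Real.log (∏ k, (gridSize lo hi τ k : ℝ)) := by
    refine Real.log_nonneg ?_
    exact_mod_cast Finset.one_le_prod' fun k _ => gridSize_pos lo hi τ k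
  have h2 : Real.log (δ / Fintype.card ι) ≤ 0 := by
    refine Real.log_nonpos (by positivity) (div_le_one_of_le₀ (hδ1.trans ?_) (by positivity))
    exact_mod_cast Fintype.card_pos
  rw [betaDelta_eq]
  linarith

/-- This identity dictates the form of `β_δ`: number of net points times the Gaussian tail at
`√β_δ`. -/
theorem prod_gridSize_mul_exp_betaDelta {ι : Type*} [Fintype ι] [Nonempty ι] (lo hi : ι → ℝ)
    (τ : ℝ) {δ : ℝ} (hδ : 0 < δ) :
    (∏ k, (gridSize lo hi τ k : ℝ)) * Real.exp (-(betaDelta lo hi τ δ / 2))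
      = δ / Fintype.card ι := by
  have h1 : 0 < ∏ k, (gridSize lo hi τ k : ℝ) :=
    Finset.prod_pos fun k _ => by exact_mod_cast gridSize_pos lo hi τ k
  have h2 : 0 < δ / Fintype.card ι := div_pos hδ (by exact_mod_cast Fintype.card_pos)
  rw [betaDelta_eq, show -((2 * Real.log (∏ k, (gridSize lo hi τ k : ℝ))
      - 2 * Real.log (δ / Fintype.card ι)) / 2)
    = Real.log (δ / Fintype.card ι) - Real.log (∏ k, (gridSize lo hi τ k : ℝ)) by ring,
    Real.exp_sub, Real.exp_log h1, Real.exp_log h2]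
  field_simp

/-! ### The uniform error bound for aggregated experts. -/

namespace GPModel.IsRegression

variable {Ω : Type*} [MeasurableSpace Ω] {P : Measure Ω} {m : ℕ}
  {ι : Type*} [Fintype ι] {D : GPModel Ω m ι} {f : Ω → EuclideanSpace ℝ ι → Vec m}

theorem measure_abs_sub_expertMean_gt_le [IsProbabilityMeasure P] (h : D.IsRegression P f)
    (j : Fin m) (i : Fin D.nExp) {ξ : EuclideanSpace ℝ ι} (hξ : ξ ∈ box D.lo D.hi) {s : ℝ} (hs : 0 ≤ s) :
    P {ω | s * D.expertStd j i ξ < |f ω ξ j - D.expertMean f j i ω ξ|}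
      ≤ ENNReal.ofReal (Real.exp (-(s ^ 2 / 2))) :=
  measure_abs_sub_postMean_gt_le (F := fun ω ξ => f ω ξ j) (h.gaussian j) (h.centred j)
    (h.covariance j) (h.σn_pos j) (h.noise_law j i) (h.noise_indep j i) (h.noise_indep_f j i)
    (h.input_mem j i) hξ hs

/-- Aggregated error bound at a point, from the errors of the experts at a nearby point. -/
theorem abs_sub_mean_le (h : D.IsRegression P f) {δ : ℝ} {j : Fin m} {ω : Ω}
    {ξ ξ' : EuclideanSpace ℝ ι} (hξ : ξ ∈ box D.lo D.hi) (hξ' : ξ' ∈ box D.lo D.hi)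
    (hd : dist ξ ξ' ≤ D.τ)
    (he : ∀ i, |f ω ξ' j - D.expertMean f j i ω ξ'|
      ≤ Real.sqrt (betaDelta D.lo D.hi D.τ (δ / D.nExp)) * D.expertStd j i ξ') :
    |f ω ξ j - D.mean f ω ξ j| ≤ D.errorBound δ ω ξ j := by
  set s := Real.sqrt (betaDelta D.lo D.hi D.τ (δ / D.nExp)) with hs
  have hs0 : 0 ≤ s := Real.sqrt_nonneg _
  have hsplit : f ω ξ j - D.mean f ω ξ j
      = ∑ i, D.weight j i ω ξ * (f ω ξ j - D.expertMean f j i ω ξ) := by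
    simp only [mul_sub, Finset.sum_sub_distrib, ← Finset.sum_mul, h.weight_sum j ω ξ hξ, one_mul,
      GPModel.mean]
  have hbound : D.errorBound δ ω ξ j = ∑ i, D.weight j i ω ξ *
      (2 * s * D.expertStd j i ξ + (s * D.Lσ j i + D.Lf j ω + D.Lμ j i ω) * D.τ) := by
    simp only [GPModel.errorBound, mul_add, Finset.sum_add_distrib, Finset.mul_sum]
    congr 1
    exact Finset.sum_congr rfl fun i _ => by ring
  rw [hsplit, hbound]
  refine (Finset.abs_sum_le_sum_abs _ _).trans (Finset.sum_le_sum fun i _ => ?_)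
  have hw := h.weight_nonneg j i ω ξ hξ
  rw [abs_mul, abs_of_nonneg hw]
  refine mul_le_mul_of_nonneg_left ?_ hw
  have h1 : |f ω ξ j - f ω ξ' j| ≤ D.Lf j ω * D.τ :=
    ((h.lipschitz_f j ω).dist_le_mul ξ hξ ξ' hξ').trans (by gcongr)
  have h2 : |D.expertMean f j i ω ξ - D.expertMean f j i ω ξ'| ≤ D.Lμ j i ω * D.τ :=
    ((h.lipschitz_mean j i ω).dist_le_mul ξ hξ ξ' hξ').trans (by gcongr)
  have h3 : |D.expertStd j i ξ - D.expertStd j i ξ'| ≤ D.Lσ j i * D.τ :=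
    ((h.lipschitz_std j i).dist_le_mul ξ hξ ξ' hξ').trans (by gcongr)
  have h4 : s * D.expertStd j i ξ' ≤ s * (D.expertStd j i ξ + D.Lσ j i * D.τ) :=
    mul_le_mul_of_nonneg_left (by linarith [(abs_le.1 h3).1]) hs0
  -- The errors at `ξ'` and the Lipschitz terms need only one copy of `s * σ`; the second copy in
  -- the factor 2 is slack.
  have h5 : 0 ≤ s * D.expertStd j i ξ := mul_nonneg hs0 (Real.sqrt_nonneg _)
  have h6 := abs_le.1 (he i)
  have h7 := abs_le.1 h1
  have h8 := abs_le.1 h2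
  refine abs_le.2 ⟨?_, ?_⟩ <;> nlinarith

/-- The explicit prediction error bound holds for each component with probability `1 - δ`. -/
theorem holdsWithProb_abs_sub_mean_le [IsProbabilityMeasure P] [Nonempty ι]
    (h : D.IsRegression P f) {δ : ℝ} (hδ : 0 < δ) (hδ1 : δ ≤ 1) (j : Fin m) :
    HoldsWithProb P (1 - δ)
      {ω | ∀ ξ ∈ box D.lo D.hi, |f ω ξ j - D.mean f ω ξ j| ≤ D.errorBound δ ω ξ j} := by
  refine holdsWithProb_of_measure_compl_le ?_ hδ.le
  classical
  rcases (box D.lo D.hi).eq_empty_or_nonempty with hB | ⟨ξ₀, hξ₀⟩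
  · simp [hB]
  have hN : 0 < D.nExp := by
    have := P.nonempty_of_neZero
    obtain ⟨ω⟩ := this
    refine Nat.pos_of_ne_zero fun h0 => ?_
    have : IsEmpty (Fin D.nExp) := by rw [h0]; infer_instance
    simpa using h.weight_sum j ω ξ₀ hξ₀
  have hN' : (1 : ℝ) ≤ D.nExp := by exact_mod_cast hN
  have hδN : 0 < δ / D.nExp := by positivity
  have hβ : 0 ≤ betaDelta D.lo D.hi D.τ (δ / D.nExp) :=
    betaDelta_nonneg _ _ _ hδN (div_le_one_of_le₀ (hδ1.trans hN') (by positivity))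
  obtain ⟨p, hp, hcov⟩ := exists_grid_box h.τ_pos fun k => (hξ₀ k).1.trans (hξ₀ k).2
  set s := Real.sqrt (betaDelta D.lo D.hi D.τ (δ / D.nExp)) with hs
  -- The net is deterministic, so the random weights and Lipschitz constants play no role in the
  -- union bound: finitely many pointwise failures cover every failure.
  have hsub : {ω | ∀ ξ ∈ box D.lo D.hi, |f ω ξ j - D.mean f ω ξ j| ≤ D.errorBound δ ω ξ j}ᶜ ⊆
      ⋃ (i : Fin D.nExp), ⋃ c, {ω | s * D.expertStd j i (p c)
        < |f ω (p c) j - D.expertMean f j i ω (p c)|} := by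
    rw [compl_subset_comm]
    intro ω hω ξ hξ
    simp only [mem_compl_iff, mem_iUnion, mem_ofPred_eq, not_exists, not_lt] at hω
    obtain ⟨c, hc⟩ := hcov ξ hξ
    exact h.abs_sub_mean_le hξ (hp c) hc fun i => hω i c
  refine (measure_mono hsub).trans ((measure_iUnion_fintype_le P _).trans ?_)
  have hi : ∀ i : Fin D.nExp, P (⋃ c, {ω | s * D.expertStd j i (p c)
        < |f ω (p c) j - D.expertMean f j i ω (p c)|}) ≤ ENNReal.ofReal (δ / D.nExp) := by
    intro i
    refine (measure_iUnion_fintype_le P _).trans ((Finset.sum_le_sum fun c _ =>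
      h.measure_abs_sub_expertMean_gt_le j i (hp c) (Real.sqrt_nonneg _)).trans ?_)
    rw [Finset.sum_const, Finset.card_univ, Fintype.card_pi, nsmul_eq_mul, Real.sq_sqrt hβ,
      ← ENNReal.ofReal_natCast, ← ENNReal.ofReal_mul (by positivity)]
    simp only [Fintype.card_fin, Nat.cast_prod]
    rw [prod_gridSize_mul_exp_betaDelta _ _ _ hδN]
    -- The dimension in `δ / n` is slack and is dropped here.
    refine ENNReal.ofReal_le_ofReal (div_le_self hδN.le ?_)
    exact_mod_cast Fintype.card_pos
  refine (Finset.sum_le_sum fun i _ => hi i).trans ?_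
  rw [Finset.sum_const, Finset.card_univ, Fintype.card_fin, nsmul_eq_mul,
    ← ENNReal.ofReal_natCast, ← ENNReal.ofReal_mul (by positivity), mul_div_cancel₀ _ (by positivity)]

end GPModel.IsRegression

/-! ### Assembly of both parts. -/

theorem theorem1 {m mu mz : ℕ} {Ω : Type*} [MeasurableSpace Ω] (P : Measure Ω)
    [IsProbabilityMeasure P] (𝕏 : Set (Vec m)) (𝕌 : Set (Vec mu))
    (f : Ω → StateInput m mu → Vec m) (g : StateInput m mu → Vec m)
    (h : ℝ → Vec m → Vec mz)
    (hh : DifferentiableOn ℝ (fun p : ℝ × Vec m => h p.1 p.2) (Ici 0 ×ˢ 𝕏))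
    (𝓜 : Set (StateInput m mu → Vec m)) (π : ControlLaw m mu)
    (V : ℝ → Vec mz → ℝ) (αlo αhi α : ℝ → ℝ) (ε : ℝ)
    (hπ : ISSLyapunovCondition 𝕏 𝕌 g h 𝓜 π V αlo αhi α ε)
    (δ : ℝ) (hδ_pos : 0 < δ) (hδ_lt : δ < 1 / m) :
    -- any prediction error bound `η` that holds for each component with probability `1 - δ`
    (∀ μ η : Ω → StateInput m mu → Vec m, (∀ ω, μ ω ∈ 𝓜) →
      (∀ j : Fin m, HoldsWithProb P (1 - δ)
        {ω | ∀ ξ ∈ jointDomain 𝕏 𝕌, |f ω ξ j - μ ω ξ j| ≤ η ω ξ j}) →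
      HoldsWithProb P (1 - m * δ)
        {ω | OutputUltimatelyBounded 𝕏 𝕌 (f ω) g (μ ω) h π
          (classKInv αlo (classKInv α
            (ENNReal.ofReal ε * worstCaseError 𝕏 𝕌 π (μ ω) (η ω) ^ 2)))}) ∧
    -- the explicit prediction error bound of Gaussian process regression
    (∀ D : GPModel Ω m (Fin m ⊕ Fin mu), D.IsRegression P f →
      jointDomain 𝕏 𝕌 ⊆ box D.lo D.hi → (∀ ω, D.mean f ω ∈ 𝓜) →
      HoldsWithProb P (1 - m * δ)
        {ω | OutputUltimatelyBounded 𝕏 𝕌 (f ω) g (D.mean f ω) h π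
          (classKInv αlo (classKInv α
            (ENNReal.ofReal ε *
              worstCaseError 𝕏 𝕌 π (D.mean f ω) (D.errorBound δ ω) ^ 2)))}) := by
  refine ⟨fun μ η hμ hη => holdsWithProb_outputUltimatelyBounded hh hπ hδ_pos.le hμ hη,
    fun D hD hbox hμ => ?_⟩
  refine holdsWithProb_outputUltimatelyBounded hh hπ hδ_pos.le hμ fun j => ?_
  -- The index `j` forces `m ≥ 1`, which supplies a coordinate and `δ ≤ 1`.
  have : Nonempty (Fin m ⊕ Fin mu) := ⟨Sum.inl j⟩
  have hm : (1 : ℝ) ≤ m := by exact_mod_cast Fin.pos j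
  have hδ1 : δ ≤ 1 := hδ_lt.le.trans (div_le_one_of_le₀ hm (by positivity))
  exact (hD.holdsWithProb_abs_sub_mean_le hδ_pos hδ1 j).mono fun ω hω ξ hξ => hω ξ (hbox hξ)
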